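/- For a finite group $G$ and a divisor $k$ of $|G|$, let $L_k(G)=\{x\in G : x^k=1\}$ and let $\mathbf{b}_k(G)=|L_k(G)|/k$ be the local breadth of $G$ at $k$. The global breadth of $G$ is $\mathbf{B}(G)=\max\{\mathbf{b}_k(G) : k \text{ divides } |G|\}$. Let $q$ be a prime power, let $\mathbb{F}_q$ be the field with $q$ elements, and let $\mathrm{PGL}(2,q)$ be the quotient of $\mathrm{GL}(2,\mathbb{F}_q)$ by its center. (a) If $q\ge 5$ is odd, then $$\mathbf{B}(\mathrm{PGL}(2,q))=\frac{q^2+q-2}{2},$$ and this maximum is attained at the divisor $k=q-1$ of $|\mathrm{PGL}(2,q)|$, that is, $\mathbf{b}_{q-1}(\mathrm{PGL}(2,q))=\mathbf{B}(\mathrm{PGL}(2,q))$. (b) If $q=2^m$ with $m\ge 2$, then $$\mathbf{B}(\mathrm{PGL}(2,q))=2^{2m-1},$$ and this maximum is attained at the divisor $k=2$ of $|\mathrm{PGL}(2,q)|$, that is, $\mathbf{b}_{2}(\mathrm{PGL}(2,q))=\mathbf{B}(\mathrm{PGL}(2,q))$. -/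

import Mathlib

open scoped MatrixGroups

/-- `L_k(G) = {x ∈ G | x ^ k = 1}`. -/
def frobeniusSet (G : Type*) [Group G] (k : ℕ) : Set G := {x | x ^ k = 1}

/-- The local breadth `b_k(G) = |L_k(G)| / k`, as a rational number (meaningful for `k ∣ |G|`). -/
noncomputable def localBreadth (G : Type*) [Group G] (k : ℕ) : ℚ :=
  ((frobeniusSet G k).ncard : ℚ) / (k : ℚ)

/-- The global breadth `B(G)` of a finite group: the maximum of `b_k(G)` over all divisors `k`
of `|G|`. -/
noncomputable def globalBreadth (G : Type*) [Group G] [Finite G] : ℚ :=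
  (Nat.card G).divisors.sup' (Nat.nonempty_divisors.mpr Nat.card_pos.ne') (localBreadth G)

/-- `PGL(2, F)` is finite when `F` is. -/
instance finite_PGL_two (F : Type*) [Field F] [Finite F] : Finite PGL(2, F) :=
  Finite.of_surjective _
    (Matrix.ProjGenLinGroup.mk_surjective (n := Fin 2) (R := F))

/-! The class of `A` in `PGL(2, F)` is killed by `k` iff `A ^ k` is scalar. By Cayley–Hamilton, `A ^
k` is `Uₖ(t, n) • A` plus a scalar, with `t`, `n` the trace and determinant, so this means that `A`
is scalar or `Uₖ(t, n) = 0`.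

For eigenvalues `a ≠ b`, the vanishing of `Uₖ` means `a ^ k = b ^ k`; for a double eigenvalue it
means `k = 0` in `F`. Split pairs are thus counted by `d = gcd(q - 1, k)`, and conjugate pairs in
the quadratic extension by `e = gcd(q + 1, k)` (`two_mul_card_lucasZeros`). Each `(t, n)` belongs to
`q² - q + rq` matrices, `r` being the number of roots in `F` of `x² - tx + n`. With `u = 1` if the
characteristic divides `k` and `u = 0` otherwise, `two_mul_ncard_frobeniusSet_PGL_two` gives `2|Lₖ|
= 2 + (d - 1)(q² + q) + (e - 1)(q² - q) + 2u(q² - 1)`.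

The maximum is then elementary: `d` and `e` divide `k`, so each equals `k` or is at most `k / 2`,
and they share at most a factor `2`. -/

/-- The Lucas sequence `U₀ = 0`, `U₁ = 1`, `Uₖ₊₂ = t Uₖ₊₁ - n Uₖ`. -/
def lucasU {R : Type*} [CommRing R] (t n : R) : ℕ → R
  | 0 => 0
  | 1 => 1
  | k + 2 => t * lucasU t n (k + 1) - n * lucasU t n k

/-! ### Lucas sequences and powers of `2 × 2` matrices -/

section Lucas

variable {R : Type*} [CommRing R]

theorem map_lucasU {S : Type*} [CommRing S] (f : R →+* S) (t n : R) (k : ℕ) :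
    f (lucasU t n k) = lucasU (f t) (f n) k := by
  induction k using lucasU.induct with
  | case1 => simp [lucasU]
  | case2 => simp [lucasU]
  | case3 k h₁ h₂ => simp [lucasU, h₁, h₂]

/-- Binet's formula, cleared of denominators: both sides satisfy the same recurrence. -/
theorem lucasU_mul_sub (a b : R) (k : ℕ) :
    lucasU (a + b) (a * b) k * (a - b) = a ^ k - b ^ k := by
  induction k using lucasU.induct with
  | case1 => simp [lucasU]
  | case2 => simp [lucasU]
  | case3 k h₁ h₂ =>
    rw [lucasU, Nat.succ_eq_add_one]
    linear_combination (a + b) * h₁ - a * b * h₂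

/-- The confluent case `Uₖ = k a ^ (k - 1)`; the factor `a` avoids the exponent `k - 1`. -/
theorem lucasU_self_mul (a : R) (k : ℕ) :
    lucasU (a + a) (a * a) k * a = k * a ^ k := by
  induction k using lucasU.induct with
  | case1 => simp [lucasU]
  | case2 => simp [lucasU]
  | case3 k h₁ h₂ =>
    rw [lucasU, Nat.succ_eq_add_one]
    push_cast at h₁ ⊢
    linear_combination (a + a) * h₁ - a * a * h₂

theorem lucasU_eq_zero_iff_of_ne {E : Type*} [Field E] {a b : E} (h : a ≠ b) (k : ℕ) :
    lucasU (a + b) (a * b) k = 0 ↔ a ^ k = b ^ k := by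
  have := lucasU_mul_sub a b k
  rw [← sub_eq_zero (a := a ^ k), ← this, mul_eq_zero, or_iff_left (sub_ne_zero.2 h)]

theorem lucasU_self_eq_zero_iff {E : Type*} [Field E] {a : E} (h : a ≠ 0) (k : ℕ) :
    lucasU (a + a) (a * a) k = 0 ↔ (k : E) = 0 := by
  have := lucasU_self_mul a k
  have h2 : lucasU (a + a) (a * a) k = 0 ↔ lucasU (a + a) (a * a) k * a = 0 := by simp [h]
  rw [h2, this]
  simp [h]

open Matrix

theorem Matrix.sq_fin_two (A : Matrix (Fin 2) (Fin 2) R) :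
    A * A = A.trace • A - A.det • (1 : Matrix (Fin 2) (Fin 2) R) := by
  ext i j
  fin_cases i <;> fin_cases j <;>
    simp [Matrix.mul_apply, Fin.sum_univ_two, Matrix.trace_fin_two, Matrix.det_fin_two] <;> ring

theorem Matrix.pow_succ_fin_two (A : Matrix (Fin 2) (Fin 2) R) (k : ℕ) :
    A ^ (k + 1) = lucasU A.trace A.det (k + 1) • A
      - (A.det * lucasU A.trace A.det k) • (1 : Matrix (Fin 2) (Fin 2) R) := by
  induction k with
  | zero => simp [lucasU]
  | succ k ih =>
    rw [pow_succ, ih, lucasU, sub_mul, smul_mul_assoc, Matrix.sq_fin_two]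
    simp only [smul_mul_assoc, one_mul]
    module

theorem Matrix.pow_scalar_iff {E : Type*} [Field E] (A : Matrix (Fin 2) (Fin 2) E) (k : ℕ) :
    A ^ k ∈ Set.range (scalar (Fin 2)) ↔
      A ∈ Set.range (scalar (Fin 2)) ∨ lucasU A.trace A.det k = 0 := by
  cases k with
  | zero => exact iff_of_true ⟨1, by simp⟩ (Or.inr rfl)
  | succ k =>
    constructor
    · rintro ⟨c, hc⟩
      by_contra! h
      -- With `Uₖ₊₁ ≠ 0`, solve `c = Uₖ₊₁ A - det A · Uₖ` for `A`.
      refine h.1 ⟨(lucasU A.trace A.det (k + 1))⁻¹ * (c + A.det * lucasU A.trace A.det k), ?_⟩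
      rw [Matrix.pow_succ_fin_two, scalar_apply, ← smul_one_eq_diagonal, eq_sub_iff_add_eq, ← add_smul] at hc
      rw [scalar_apply, ← smul_one_eq_diagonal, mul_smul, hc, smul_smul, inv_mul_cancel₀ h.2, one_smul]
    · rintro (⟨c, rfl⟩ | h)
      · exact ⟨c ^ (k + 1), by simp [map_pow]⟩
      · refine ⟨- (A.det * lucasU A.trace A.det k), ?_⟩
        rw [Matrix.pow_succ_fin_two, h, zero_smul, zero_sub]
        rw [scalar_apply, ← smul_one_eq_diagonal, neg_smul]

end Lucas

/-! ### Matrices with prescribed trace and determinant -/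

section CountMatrices

open Classical in
theorem card_mul_eq {E : Type*} [Field E] [Fintype E] (m : E) :
    (Finset.univ.filter fun p : E × E => p.1 * p.2 = m).card + 1 =
      Fintype.card E + (if m = 0 then Fintype.card E else 0) := by
  have h0 : ∀ b : E, (Finset.univ.filter fun c : E => b * c = m).card =
      if b = 0 then (if m = 0 then Fintype.card E else 0) else 1 := by
    intro b
    split_ifs with hb hm
    · simp [hb, hm]
    · simp [hb, Ne.symm hm]
    · rw [Finset.card_eq_one]
      refine ⟨b⁻¹ * m, ?_⟩
      ext c
      simp [eq_inv_mul_iff_mul_eq₀ hb]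
  have h1 : (Finset.univ.filter fun p : E × E => p.1 * p.2 = m).card =
      ∑ b : E, (Finset.univ.filter fun c : E => b * c = m).card := by
    rw [← Finset.card_sigma]
    refine Finset.card_nbij' (fun p => ⟨p.1, p.2⟩) (fun p => (p.1, p.2)) ?_ ?_ ?_ ?_ <;>
      simp [Set.MapsTo, Set.LeftInvOn]
  rw [h1, ← Finset.add_sum_erase _ _ (Finset.mem_univ (0 : E)), h0, if_pos rfl,
    Finset.sum_congr rfl (g := fun _ => 1) fun b hb => by rw [h0, if_neg (Finset.ne_of_mem_erase hb)]]
  have := Fintype.card_pos (α := E)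
  simp [Finset.card_erase_of_mem]
  omega

open Classical in
/-- The number of `2 × 2` matrices with given trace and determinant. -/
theorem card_trace_det {E : Type*} [Field E] [Fintype E] (t n : E) :
    (Finset.univ.filter fun A : Matrix (Fin 2) (Fin 2) E => A.trace = t ∧ A.det = n).card
      + Fintype.card E = Fintype.card E ^ 2 +
      (Finset.univ.filter fun x : E => x * x - t * x + n = 0).card * Fintype.card E := by
  -- The diagonal is `(a, t - a)`, and the off-diagonal entries have product `a(t - a) - n`.
  have h1 : (Finset.univ.filter fun A : Matrix (Fin 2) (Fin 2) E =>
      A.trace = t ∧ A.det = n).card = ∑ a : E,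
        (Finset.univ.filter fun p : E × E => p.1 * p.2 = a * (t - a) - n).card := by
    rw [← Finset.card_sigma]
    refine Finset.card_nbij' (fun A => ⟨A 0 0, (A 0 1, A 1 0)⟩)
      (fun p => !![p.1, p.2.1; p.2.2, t - p.1]) ?_ ?_ ?_ ?_
    · intro A
      simp only [Finset.coe_filter, Set.mem_ofPred_eq, Finset.coe_sigma, Set.mem_sigma_iff]
      rw [Matrix.trace_fin_two, Matrix.det_fin_two]
      rintro ⟨-, rfl, rfl⟩
      simp
    · rintro ⟨a, b, c⟩
      simp [Matrix.trace_fin_two, Matrix.det_fin_two]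
      intro h; rw [h]; ring
    · intro A
      simp only [Finset.coe_filter, Set.mem_ofPred_eq]
      rw [Matrix.trace_fin_two]
      rintro ⟨-, rfl, -⟩
      ext i j
      fin_cases i <;> fin_cases j <;> simp
    · rintro ⟨a, b, c⟩ _
      simp
  -- The product has extra factorizations exactly when it is zero, that is, when `a` is a root of
  -- `x² - tx + n`.
  have h2 : ∑ a : E, ((Finset.univ.filter fun p : E × E =>
      p.1 * p.2 = a * (t - a) - n).card + 1) = ∑ a : E, (Fintype.card E +
        (if a * a - t * a + n = 0 then Fintype.card E else 0)) := by
    refine Finset.sum_congr rfl fun a _ => ?_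
    rw [card_mul_eq]
    congr 2
    rw [← neg_eq_zero, eq_iff_iff]
    ring_nf
  rw [Finset.sum_add_distrib, ← h1] at h2
  simp only [Finset.sum_const, Finset.card_univ, smul_eq_mul, mul_one, Finset.sum_add_distrib,
    ← Finset.sum_filter] at h2
  rw [h2, sq]

end CountMatrices

/-! ### Numerical inequalities -/

theorem eq_or_two_mul_le_of_dvd {d k : ℕ} (hk : 0 < k) (h : d ∣ k) : d = k ∨ 2 * d ≤ k := by
  obtain ⟨c, rfl⟩ := h
  rcases c with _ | _ | c
  · simp at hk
  · simp
  · right; nlinarith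

theorem le_two_of_dvd_sub_one_of_dvd_add_one {q e : ℕ} (hq : 1 ≤ q) (h1 : e ∣ q - 1) (h2 : e ∣ q + 1) : e ≤ 2 := by
  have := Nat.dvd_sub h2 h1
  rw [show q + 1 - (q - 1) = 2 by omega] at this
  exact Nat.le_of_dvd two_pos this

theorem mul_dvd_of_coprime_multiple {p q d k : ℕ} (hpq : p ∣ q) (hpk : p ∣ k) (hdk : d ∣ k)
    (hd : d.Coprime q) : p * d ∣ k :=
  Nat.Coprime.mul_dvd_of_dvd_of_dvd ((hd.coprime_dvd_right hpq).symm) hpk hdk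

/-- If `d = k` then `e` divides both `q - 1` and `q + 1`, so `e ≤ 2`; symmetrically for `e = k`.
Otherwise both are at most `k / 2`. Equality holds for `d = k = q - 1`, `e = 2`. -/
theorem breadth_bound_odd {q k d e : ℕ} (hq : 5 ≤ q) (hk : 0 < k) (hdk : d ∣ k) (hek : e ∣ k)
    (hdq : d ∣ q - 1) (heq : e ∣ q + 1) :
    2 + ((d : ℤ) - 1) * (q ^ 2 + q) + ((e : ℤ) - 1) * (q ^ 2 - q) ≤ k * (q ^ 2 + q - 2) := by
  have hd1 := Nat.le_of_dvd (by omega) hdq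
  rcases eq_or_two_mul_le_of_dvd hk hdk with rfl | hd
  · have he : e ≤ 2 := le_two_of_dvd_sub_one_of_dvd_add_one (by omega) (hek.trans hdq) heq
    have h1 : (d : ℤ) ≤ q - 1 := by omega
    have h2 : ((e : ℤ) - 1) * (q ^ 2 - q) ≤ 1 * (q ^ 2 - q) :=
      mul_le_mul_of_nonneg_right (by omega) (by nlinarith)
    nlinarith
  · rcases eq_or_two_mul_le_of_dvd hk hek with rfl | he
    · have hd : d ≤ 2 := le_two_of_dvd_sub_one_of_dvd_add_one (by omega) hdq (hdk.trans heq)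
      have h2 : ((d : ℤ) - 1) * (q ^ 2 + q) ≤ 1 * (q ^ 2 + q) :=
        mul_le_mul_of_nonneg_right (by omega) (by positivity)
      have h3 : (2 : ℤ) ≤ e := by
        have := Nat.pos_of_dvd_of_pos hdk hk
        omega
      nlinarith [mul_nonneg (sub_nonneg.2 h3) (show (0 : ℤ) ≤ q - 1 by omega)]
    · have h2 : (2 * (d : ℤ)) * (q ^ 2 + q) ≤ k * (q ^ 2 + q) :=
        mul_le_mul_of_nonneg_right (by omega) (by positivity)
      have h3 : (2 * (e : ℤ)) * (q ^ 2 - q) ≤ k * (q ^ 2 - q) :=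
        mul_le_mul_of_nonneg_right (by omega) (by nlinarith)
      nlinarith [mul_nonneg (show (0 : ℤ) ≤ k by omega) (show (0 : ℤ) ≤ q - 2 by omega)]

theorem breadth_bound_even {q k d e : ℕ} (hq : 4 ≤ q) (hq2 : Even q) (hk : 0 < k) (hdk : d ∣ k)
    (hek : e ∣ k) (hdq : d ∣ q - 1) (heq : e ∣ q + 1) :
    2 + ((d : ℤ) - 1) * (q ^ 2 + q) + ((e : ℤ) - 1) * (q ^ 2 - q) ≤ k * q ^ 2 := by
  have hd1 := Nat.le_of_dvd (by omega) hdq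
  have key : ∀ c, c ∣ q - 1 → c ∣ q + 1 → c ≤ 1 := by
    intro c h1 h2
    have h3 := le_two_of_dvd_sub_one_of_dvd_add_one (by omega) h1 h2
    have h4 : c ≠ 2 := by
      rintro rfl
      obtain ⟨r, rfl⟩ := hq2
      omega
    omega
  rcases eq_or_two_mul_le_of_dvd hk hdk with rfl | hd
  · have he : e ≤ 1 := key e (hek.trans hdq) heq
    have h1 : (d : ℤ) ≤ q - 1 := by omega
    have h2 : ((e : ℤ) - 1) * (q ^ 2 - q) ≤ 0 * (q ^ 2 - q) :=
      mul_le_mul_of_nonneg_right (by omega) (by nlinarith)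
    nlinarith
  · rcases eq_or_two_mul_le_of_dvd hk hek with rfl | he
    · have hd : d ≤ 1 := key d hdq (hdk.trans heq)
      have h2 : ((d : ℤ) - 1) * (q ^ 2 + q) ≤ 0 * (q ^ 2 + q) :=
        mul_le_mul_of_nonneg_right (by omega) (by positivity)
      nlinarith
    · have h2 : (2 * (d : ℤ)) * (q ^ 2 + q) ≤ k * (q ^ 2 + q) :=
        mul_le_mul_of_nonneg_right (by omega) (by positivity)
      have h3 : (2 * (e : ℤ)) * (q ^ 2 - q) ≤ k * (q ^ 2 - q) :=
        mul_le_mul_of_nonneg_right (by omega) (by nlinarith)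
      nlinarith

/-- Since `d, e ≤ k / 2`, the main terms are at most `k q²`, and the remainder `2 - 2q² + 2(q² - 1)`
cancels exactly. -/
theorem breadth_bound_of_mul_le {q k d e p : ℕ} (hd : p * d ≤ k) (he : p * e ≤ k) (hq : 1 ≤ q)
    (hp : 2 ≤ p) :
    2 + ((d : ℤ) - 1) * (q ^ 2 + q) + ((e : ℤ) - 1) * (q ^ 2 - q) + 2 * (q ^ 2 - 1) ≤
      k * q ^ 2 := by
  have h2 : (2 * (d : ℤ)) * (q ^ 2 + q) ≤ k * (q ^ 2 + q) :=
    mul_le_mul_of_nonneg_right (by norm_cast; nlinarith) (by positivity)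
  have h3 : (2 * (e : ℤ)) * (q ^ 2 - q) ≤ k * (q ^ 2 - q) :=
    mul_le_mul_of_nonneg_right (by norm_cast; nlinarith) (by nlinarith)
  nlinarith

/-! ### Roots of unity and split eigenvalue pairs -/

section Units

open Classical in
theorem card_pow_eq_one_units {E : Type*} [Field E] [Fintype E] (k : ℕ) :
    (Finset.univ.filter fun x : Eˣ => x ^ k = 1).card = (Fintype.card E - 1).gcd k := by
  rw [← Fintype.card_units, ← Nat.card_eq_fintype_card, ← IsCyclic.card_powMonoidHom_ker,
    Nat.card_eq_fintype_card, Fintype.card_subtype]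
  simp [MonoidHom.mem_ker]

open Classical in
theorem card_pow_eq_one_ne_zero {E : Type*} [Field E] [Fintype E] (k : ℕ) :
    (Finset.univ.filter fun x : E => x ≠ 0 ∧ x ^ k = 1).card = (Fintype.card E - 1).gcd k := by
  rw [← card_pow_eq_one_units]
  symm
  refine Finset.card_nbij (fun x : Eˣ => (x : E)) ?_ (fun x _ y _ h => Units.ext h) ?_
  · intro x
    simp [Units.ext_iff]
  · intro x
    simp only [Finset.coe_filter, Set.mem_ofPred_eq, Set.mem_image, Finset.mem_univ, true_and]
    rintro ⟨h0, h1⟩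
    exact ⟨Units.mk0 x h0, by simpa [Units.ext_iff] using h1, rfl⟩

open Classical in
/-- Ordered pairs of nonzero eigenvalues whose Lucas number vanishes. -/
theorem card_pairs_lucasU {E : Type*} [Field E] [Fintype E] (k : ℕ) :
    (Finset.univ.filter fun p : E × E =>
        p.1 * p.2 ≠ 0 ∧ lucasU (p.1 + p.2) (p.1 * p.2) k = 0).card =
      (Fintype.card E - 1) *
        (((Fintype.card E - 1).gcd k - 1) + if (k : E) = 0 then 1 else 0) := by
  -- Pass from `(a, b)` to `(a, b / a)`: the ratio is a nontrivial `k`-th root of unity, or `1` when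
  -- `k = 0` in `E`.
  have h1 : (Finset.univ.filter fun p : E × E =>
        p.1 * p.2 ≠ 0 ∧ lucasU (p.1 + p.2) (p.1 * p.2) k = 0).card =
      ((Finset.univ.erase (0 : E)) ×ˢ
        (Finset.univ.filter fun x : E => x ≠ 0 ∧
          ((x ≠ 1 ∧ x ^ k = 1) ∨ (x = 1 ∧ (k : E) = 0)))).card := by
    refine Finset.card_nbij' (fun p => (p.1, p.2 / p.1)) (fun p => (p.1, p.1 * p.2)) ?_ ?_ ?_ ?_
    · rintro ⟨a, b⟩
      simp only [ne_eq, mul_eq_zero, not_or, Finset.coe_filter, Finset.mem_univ, true_and,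
        Set.mem_ofPred_eq, Finset.coe_product, Finset.coe_erase, Finset.coe_univ, Set.mem_prod,
        Set.mem_sdiff, Set.mem_univ, Set.mem_singleton_iff, div_eq_zero_iff, and_imp]
      intro ha hb h
      refine ⟨ha, by tauto, ?_⟩
      by_cases hab : a = b
      · subst hab
        right
        exact ⟨div_self ha, (lucasU_self_eq_zero_iff ha k).1 h⟩
      · left
        rw [lucasU_eq_zero_iff_of_ne hab] at h
        refine ⟨fun h' => hab ((div_eq_one_iff_eq ha).1 h').symm, ?_⟩
        rw [div_pow, h, div_self (pow_ne_zero _ hb)]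
    · rintro ⟨a, b⟩
      simp only [ne_eq, Finset.coe_product, Finset.coe_erase, Finset.coe_univ, Finset.coe_filter,
        Finset.mem_univ, true_and, Set.mem_prod, Set.mem_sdiff, Set.mem_univ,
        Set.mem_singleton_iff, Set.mem_ofPred_eq, mul_eq_zero, not_or, and_imp]
      rintro ha hb (⟨h1, h2⟩ | ⟨rfl, h2⟩)
      · refine ⟨⟨ha, ha, hb⟩, (lucasU_eq_zero_iff_of_ne ?_ k).2 ?_⟩
        · intro h
          exact h1 (mul_left_cancel₀ ha (by rw [← h, mul_one]))
        · rw [mul_pow, h2, mul_one]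
      · refine ⟨⟨ha, ha, hb⟩, ?_⟩
        rw [mul_one]
        exact (lucasU_self_eq_zero_iff ha k).2 h2
    · rintro ⟨a, b⟩
      simp only [ne_eq, mul_eq_zero, not_or, Finset.coe_filter, Finset.mem_univ, true_and,
        Set.mem_ofPred_eq, and_imp, Prod.mk.injEq]
      intro ha hb h
      exact mul_div_cancel₀ _ ha
    · rintro ⟨a, b⟩
      simp +contextual
  rw [h1, Finset.card_product, Finset.card_erase_of_mem (Finset.mem_univ _), Finset.card_univ]
  congr 1
  have h2 : (Finset.univ.filter fun x : E => x ≠ 0 ∧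
          ((x ≠ 1 ∧ x ^ k = 1) ∨ (x = 1 ∧ (k : E) = 0))) =
      ((Finset.univ.filter fun x : E => x ≠ 0 ∧ x ^ k = 1).erase 1) ∪
        (if (k : E) = 0 then {1} else ∅) := by
    ext x
    split_ifs <;> by_cases hx : x = 1 <;> simp [*]
  rw [h2, Finset.card_union_of_disjoint, Finset.card_erase_of_mem (by simp),
    card_pow_eq_one_ne_zero]
  · split_ifs <;> simp
  · split_ifs <;> simp

end Units

/-! ### The quadratic extension and its Frobenius -/

section QuadraticExtension

variable {F K : Type*} [Field F] [Fintype F] [Field K] [Algebra F K]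

theorem mem_range_algebraMap_iff_pow_card (x : K) :
    x ∈ Set.range (algebraMap F K) ↔ x ^ Fintype.card F = x := by
  classical
  constructor
  · rintro ⟨y, rfl⟩
    rw [← map_pow, FiniteField.pow_card]
  · intro h
    have hne := FiniteField.X_pow_card_sub_X_ne_zero K (Fintype.one_lt_card (α := F))
    -- The image of `F` already supplies as many roots of `X ^ q - X` as its degree allows.
    have h1 : (Finset.univ.image (algebraMap F K)) ⊆
        (Polynomial.X ^ Fintype.card F - Polynomial.X : Polynomial K).roots.toFinset := by
      intro y hy
      obtain ⟨z, -, rfl⟩ := Finset.mem_image.1 hy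
      simp [hne, ← map_pow, FiniteField.pow_card]
    have h2 := Finset.eq_of_subset_of_card_le h1 (by
      rw [Finset.card_image_of_injective _ (algebraMap F K).injective, Finset.card_univ]
      refine (Multiset.toFinset_card_le _).trans ((Polynomial.card_roots' _).trans ?_)
      rw [FiniteField.X_pow_card_sub_X_natDegree_eq K Fintype.one_lt_card])
    have h3 : x ∈ (Polynomial.X ^ Fintype.card F - Polynomial.X : Polynomial K).roots.toFinset := by
      simp [hne, h]
    rw [← h2] at h3
    obtain ⟨z, -, rfl⟩ := Finset.mem_image.1 h3
    exact ⟨z, rfl⟩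

/-- The other root of a quadratic over `F` having a root `x ∉ F` is the conjugate of `x`. -/
theorem trace_norm_of_root {t n : F} {x : K} (hx : x ∉ Set.range (algebraMap F K))
    (h : x * x - algebraMap F K t * x + algebraMap F K n = 0) :
    algebraMap F K t = x + x ^ Fintype.card F ∧ algebraMap F K n = x * x ^ Fintype.card F := by
  have h1 := congrArg (FiniteField.frobeniusAlgHom F K) h
  simp only [map_add, map_sub, map_mul, AlgHom.commutes, map_zero,
    FiniteField.coe_frobeniusAlgHom] at h1
  set y := x ^ Fintype.card F with hy
  have hne : x - y ≠ 0 := fun h0 => hx ((mem_range_algebraMap_iff_pow_card x).2 (sub_eq_zero.1 h0).symm)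
  have h2 : algebraMap F K t = x + y := by
    apply mul_left_cancel₀ hne
    linear_combination h1 - h
  refine ⟨h2, ?_⟩
  rw [h2] at h
  linear_combination h

/-- A quadratic without roots is irreducible, so adjoining a root gives a degree-two extension, and
finite fields have only one up to isomorphism. -/
theorem exists_root_of_no_root [Finite K] (hK : Module.finrank F K = 2) (t n : F)
    (h : ∀ x : F, x * x - t * x + n ≠ 0) :
    ∃ x : K, x * x - algebraMap F K t * x + algebraMap F K n = 0 := by
  let f : Polynomial F := Polynomial.X ^ 2 - Polynomial.C t * Polynomial.X + Polynomial.C n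
  have hdeg : f.natDegree = 2 := by
    simp only [f]; compute_degree!
  have hirr : Irreducible f := by
    rw [Polynomial.irreducible_iff_roots_eq_zero_of_degree_le_three (by omega) (by omega),
      Multiset.eq_zero_iff_forall_notMem]
    intro x hx
    have := Polynomial.isRoot_of_mem_roots hx
    simp only [f, Polynomial.IsRoot, Polynomial.eval_add, Polynomial.eval_sub, Polynomial.eval_pow,
      Polynomial.eval_X, Polynomial.eval_mul, Polynomial.eval_C] at this
    exact h x (by rw [← this]; ring)
  have : Fact (Irreducible f) := ⟨hirr⟩
  obtain ⟨p, hp⟩ := CharP.exists F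
  have : Fact p.Prime := ⟨CharP.char_is_prime F p⟩
  have hfr : Module.finrank F (AdjoinRoot f) = 2 := by
    rw [← hdeg]; exact finrank_quotient_span_eq_natDegree
  let e : AdjoinRoot f ≃ₐ[F] K := (FiniteField.algEquivExtension F p 2 (AdjoinRoot f) hfr).trans
    (FiniteField.algEquivExtension F p 2 K hK).symm
  refine ⟨e (AdjoinRoot.root f), ?_⟩
  have h1 : Polynomial.aeval (AdjoinRoot.root f) f = 0 := by
    rw [AdjoinRoot.aeval_eq, AdjoinRoot.mk_self]
  have h2 := congrArg e h1
  simp only [f, map_add, map_sub, map_mul, map_pow, Polynomial.aeval_X, Polynomial.aeval_C,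
    AlgEquiv.commutes, map_zero] at h2
  rw [← h2]; ring

variable [Fintype K]

open Classical in
/-- Elements of `Kˣ \ Fˣ` whose `k`-th power lies in `F`, for `K / F` quadratic. -/
theorem card_pow_mem_range (hK : Fintype.card K = Fintype.card F ^ 2) (k : ℕ) :
    (Finset.univ.filter fun x : K => x ∉ Set.range (algebraMap F K) ∧
      x ^ k ∈ Set.range (algebraMap F K)).card =
      (Fintype.card F - 1) * ((Fintype.card F + 1).gcd k - 1) := by
  have hq := Fintype.one_lt_card (α := F)
  have hfac : Fintype.card K - 1 = (Fintype.card F - 1) * (Fintype.card F + 1) := by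
    obtain ⟨r, hr⟩ := Nat.exists_eq_add_of_lt hq
    rw [hK, hr]
    simp only [Nat.add_sub_cancel]
    apply Nat.sub_eq_of_eq_add; ring
  have hmem : ∀ x : K, x ≠ 0 →
      (x ∈ Set.range (algebraMap F K) ↔ x ^ (Fintype.card F - 1) = 1) := by
    intro x hx
    rw [mem_range_algebraMap_iff_pow_card]
    conv_lhs => rw [← Nat.sub_add_cancel hq.le, pow_succ, mul_eq_right₀ hx]
  -- For `x ≠ 0`, lying in `F` means `x ^ (q - 1) = 1`, so the set is a difference of two groups of
  -- roots of unity.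
  have h1 : (Finset.univ.filter fun x : K => x ∉ Set.range (algebraMap F K) ∧
      x ^ k ∈ Set.range (algebraMap F K)) =
      (Finset.univ.filter fun x : K => x ≠ 0 ∧ x ^ (k * (Fintype.card F - 1)) = 1) \
      (Finset.univ.filter fun x : K => x ≠ 0 ∧ x ^ (Fintype.card F - 1) = 1) := by
    ext x
    by_cases hx : x = 0
    · subst hx
      have : (0 : K) ∈ Set.range (algebraMap F K) := ⟨0, map_zero _⟩
      simp [-Set.mem_range, this]
    · simp only [Finset.mem_filter, Finset.mem_sdiff, Finset.mem_univ, true_and, hmem x hx,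
        hmem (x ^ k) (pow_ne_zero _ hx), pow_mul, ne_eq, hx, not_false_eq_true]
      tauto
  rw [h1, Finset.card_sdiff_of_subset, card_pow_eq_one_ne_zero, card_pow_eq_one_ne_zero, hfac,
    mul_comm k, Nat.gcd_mul_left, Nat.gcd_eq_right (dvd_mul_right _ _), Nat.mul_sub, mul_one]
  intro x
  simp only [Finset.mem_filter, Finset.mem_univ, true_and]
  rintro ⟨h0, h⟩
  exact ⟨h0, by rw [mul_comm, pow_mul, h, one_pow]⟩

end QuadraticExtension

/-! ### Counting the zeros of the Lucas polynomial -/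

section Quadratics

open Classical

/-- The pairs (trace, determinant) of nonsingular matrices whose `k`-th Lucas number vanishes. -/
noncomputable def lucasZeros (F : Type*) [Field F] [Fintype F] (k : ℕ) : Finset (F × F) :=
  Finset.univ.filter fun p => p.2 ≠ 0 ∧ lucasU p.1 p.2 k = 0

variable {F : Type*} [Field F] [Fintype F]

theorem mem_lucasZeros {k : ℕ} {p : F × F} :
    p ∈ lucasZeros F k ↔ p.2 ≠ 0 ∧ lucasU p.1 p.2 k = 0 := by
  simp [lucasZeros]

/-- A pair `(t, n)` with a chosen root `x` is the same as the ordered eigenvalue pair `(x, t - x)`.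
-/
theorem sum_card_roots_lucasZeros (k : ℕ) :
    ∑ p ∈ lucasZeros F k, (Finset.univ.filter fun x : F => x * x - p.1 * x + p.2 = 0).card =
      (Fintype.card F - 1) *
        (((Fintype.card F - 1).gcd k - 1) + if (k : F) = 0 then 1 else 0) := by
  rw [← card_pairs_lucasU, ← Finset.card_sigma]
  refine Finset.card_nbij' (fun s => (s.2, s.1.1 - s.2))
    (fun p => ⟨(p.1 + p.2, p.1 * p.2), p.1⟩) ?_ ?_ ?_ ?_
  · rintro ⟨⟨t, n⟩, x⟩ h
    simp only [Finset.coe_sigma, Set.mem_sigma_iff, Finset.mem_coe, mem_lucasZeros,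
      Finset.mem_filter, Finset.mem_univ, true_and] at h ⊢
    have hn : x * (t - x) = n := by linear_combination -h.2
    rw [hn, add_sub_cancel]
    exact h.1
  · rintro ⟨a, b⟩ h
    simp only [Finset.coe_sigma, Set.mem_sigma_iff, Finset.mem_coe, mem_lucasZeros,
      Finset.mem_filter, Finset.mem_univ, true_and] at h ⊢
    exact ⟨h, by ring⟩
  · rintro ⟨⟨t, n⟩, x⟩ h
    simp only [Finset.coe_sigma, Set.mem_sigma_iff, Finset.mem_coe, mem_lucasZeros,
      Finset.mem_filter, Finset.mem_univ, true_and] at h ⊢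
    have hn : x * (t - x) = n := by linear_combination -h.2
    rw [hn, add_sub_cancel]
  · rintro ⟨a, b⟩ h
    simp

theorem card_lucasZeros_double (k : ℕ) :
    ((lucasZeros F k).filter fun p => ∃ a, p.1 = a + a ∧ p.2 = a * a).card =
      (Fintype.card F - 1) * if (k : F) = 0 then 1 else 0 := by
  have h : (lucasZeros F k).filter (fun p => ∃ a, p.1 = a + a ∧ p.2 = a * a) =
      (Finset.univ.filter fun a : F => a ≠ 0 ∧ (k : F) = 0).image fun a => (a + a, a * a) := by
    ext ⟨t, n⟩
    simp only [Finset.mem_filter, mem_lucasZeros, Finset.mem_image, Finset.mem_univ, true_and,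
      Prod.mk.injEq]
    constructor
    · rintro ⟨⟨hn, hU⟩, a, rfl, rfl⟩
      have ha : a ≠ 0 := left_ne_zero_of_mul hn
      exact ⟨a, ⟨ha, (lucasU_self_eq_zero_iff ha k).1 hU⟩, rfl, rfl⟩
    · rintro ⟨a, ⟨ha, hk⟩, rfl, rfl⟩
      exact ⟨⟨mul_ne_zero ha ha, (lucasU_self_eq_zero_iff ha k).2 hk⟩, a, rfl, rfl⟩
  rw [h, Finset.card_image_of_injective]
  · split_ifs with hk
    · simp [hk, Finset.filter_ne', Finset.card_erase_of_mem]
    · simp [hk]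
  · intro a b hab
    simp only [Prod.mk.injEq] at hab
    -- Comparing squares as well as doubles keeps this valid in characteristic two.
    have : (a - b) * (a - b) = 0 := by linear_combination hab.2 - b * hab.1
    exact sub_eq_zero.1 (mul_self_eq_zero.1 this)

variable {K : Type*} [Field K] [Fintype K] [Algebra F K]

/-- The roots are `x` and `x ^ q`, so `Uₖ = 0` reads `x ^ k = (x ^ k) ^ q`, that is, `x ^ k ∈ F`. -/
theorem sum_card_nonrational_roots_lucasZeros (hK : Fintype.card K = Fintype.card F ^ 2) (k : ℕ) :
    ∑ p ∈ lucasZeros F k, (Finset.univ.filter fun x : K => x ∉ Set.range (algebraMap F K) ∧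
        x * x - algebraMap F K p.1 * x + algebraMap F K p.2 = 0).card =
      (Fintype.card F - 1) * ((Fintype.card F + 1).gcd k - 1) := by
  have hinj := (algebraMap F K).injective
  have key : ∀ (p : F × F) (x : K), x ∉ Set.range (algebraMap F K) →
      algebraMap F K p.1 = x + x ^ Fintype.card F →
      algebraMap F K p.2 = x * x ^ Fintype.card F →
      (p ∈ lucasZeros F k ↔ x ^ k ∈ Set.range (algebraMap F K)) := by
    intro p x hx h1 h2
    have hx0 : x ≠ 0 := by
      rintro rfl
      exact hx ⟨0, map_zero _⟩
    have hne : x ≠ x ^ Fintype.card F := fun h =>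
      hx ((mem_range_algebraMap_iff_pow_card x).2 h.symm)
    rw [mem_lucasZeros, mem_range_algebraMap_iff_pow_card, ← map_ne_zero_iff _ hinj,
      ← map_eq_zero_iff _ hinj, map_lucasU, h1, h2, lucasU_eq_zero_iff_of_ne hne,
      and_iff_right (mul_ne_zero hx0 (pow_ne_zero _ hx0)), ← pow_mul, ← pow_mul, mul_comm k,
      eq_comm]
  rw [← card_pow_mem_range hK, ← Finset.card_sigma]
  refine Finset.card_nbij (fun s => s.2) ?_ ?_ ?_
  · rintro ⟨p, x⟩ h
    simp only [Finset.coe_sigma, Set.mem_sigma_iff, Finset.mem_coe,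
      Finset.mem_filter, Finset.mem_univ, true_and] at h ⊢
    obtain ⟨h1, h2⟩ := trace_norm_of_root h.2.1 h.2.2
    exact ⟨h.2.1, (key p x h.2.1 h1 h2).1 h.1⟩
  · rintro ⟨p, x⟩ h ⟨p', x'⟩ h' hxx
    simp only [Finset.coe_sigma, Set.mem_sigma_iff, Finset.mem_coe,
      Finset.mem_filter, Finset.mem_univ, true_and] at h h' hxx
    subst hxx
    obtain ⟨h1, h2⟩ := trace_norm_of_root h.2.1 h.2.2
    obtain ⟨h3, h4⟩ := trace_norm_of_root h'.2.1 h'.2.2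
    have : p = p' := Prod.ext (hinj (h1.trans h3.symm)) (hinj (h2.trans h4.symm))
    rw [this]
  · intro x h
    simp only [Finset.mem_coe, Finset.mem_filter, Finset.mem_univ, true_and] at h
    have hqq : (x ^ Fintype.card F) ^ Fintype.card F = x := by
      rw [← pow_mul, ← sq, ← hK, FiniteField.pow_card]
    have hfr := map_add (FiniteField.frobeniusAlgHom F K) x (x ^ Fintype.card F)
    simp only [FiniteField.coe_frobeniusAlgHom] at hfr
    obtain ⟨t, ht⟩ := (mem_range_algebraMap_iff_pow_card (F := F) (x + x ^ Fintype.card F)).2 (by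
      rw [hfr, hqq, add_comm])
    obtain ⟨n, hn⟩ := (mem_range_algebraMap_iff_pow_card (F := F) (x * x ^ Fintype.card F)).2 (by
      rw [mul_pow, hqq, mul_comm])
    refine ⟨⟨(t, n), x⟩, ?_, rfl⟩
    simp only [Finset.coe_sigma, Set.mem_sigma_iff, Finset.mem_coe,
      Finset.mem_filter, Finset.mem_univ, true_and]
    refine ⟨(key (t, n) x h.1 ht hn).2 h.2, h.1, ?_⟩
    rw [ht, hn]; ring

/-- The indicator restores the multiplicity of a double root. Summing over `lucasZeros` yields twice
its cardinality. -/
theorem two_eq_card_roots (hK : Module.finrank F K = 2) (t n : F) :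
    2 = (Finset.univ.filter fun x : F => x * x - t * x + n = 0).card +
      (Finset.univ.filter fun x : K => x ∉ Set.range (algebraMap F K) ∧
        x * x - algebraMap F K t * x + algebraMap F K n = 0).card +
      if ∃ a, t = a + a ∧ n = a * a then 1 else 0 := by
  by_cases h : ∃ a : F, a * a - t * a + n = 0
  · obtain ⟨a, ha⟩ := h
    obtain ⟨b, rfl⟩ : ∃ b, t = a + b := ⟨t - a, by ring⟩
    obtain rfl : n = a * b := by linear_combination ha
    have h1 : (Finset.univ.filter fun x : F => x * x - (a + b) * x + a * b = 0) = {a, b} := by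
      ext x
      have h0 : x * x - (a + b) * x + a * b = (x - a) * (x - b) := by ring
      simp [h0, sub_eq_zero]
    have h2 : (Finset.univ.filter fun x : K => x ∉ Set.range (algebraMap F K) ∧
        x * x - algebraMap F K (a + b) * x + algebraMap F K (a * b) = 0) = ∅ := by
      refine Finset.filter_eq_empty_iff.2 fun x _ hx => hx.1 ?_
      have h3 : (x - algebraMap F K a) * (x - algebraMap F K b) = 0 := by
        rw [← hx.2, map_add, map_mul]; ring
      rcases mul_eq_zero.1 h3 with h3 | h3
      · exact ⟨a, (sub_eq_zero.1 h3).symm⟩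
      · exact ⟨b, (sub_eq_zero.1 h3).symm⟩
    rw [h1, h2]
    by_cases hab : a = b
    · subst hab
      rw [if_pos ⟨a, rfl, rfl⟩]
      simp
    · rw [if_neg, Finset.card_pair hab]
      · simp
      · rintro ⟨c, h3, h4⟩
        have h5 : (a - c) * (a - c) = 0 := by linear_combination a * h3 - h4
        have h6 := sub_eq_zero.1 (mul_self_eq_zero.1 h5)
        subst h6
        exact hab (add_left_cancel h3).symm
  · push Not at h
    rw [if_neg, Finset.filter_eq_empty_iff.2 fun x _ => h x]
    · obtain ⟨x, hx⟩ := exists_root_of_no_root (K := K) hK t n h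
      have hxF : ∀ y : K, y * y - algebraMap F K t * y + algebraMap F K n = 0 →
          y ∉ Set.range (algebraMap F K) := by
        rintro _ hy ⟨y, rfl⟩
        apply h y
        apply (algebraMap F K).injective
        simpa using hy
      obtain ⟨h1, h2⟩ := trace_norm_of_root (hxF x hx) hx
      have h3 : (Finset.univ.filter fun y : K => y ∉ Set.range (algebraMap F K) ∧
          y * y - algebraMap F K t * y + algebraMap F K n = 0) = {x, x ^ Fintype.card F} := by
        ext y
        have h4 : y * y - algebraMap F K t * y + algebraMap F K n = 0 ↔
            y = x ∨ y = x ^ Fintype.card F := by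
          rw [h1, h2, show y * y - (x + x ^ Fintype.card F) * y + x * x ^ Fintype.card F =
            (y - x) * (y - x ^ Fintype.card F) by ring, mul_eq_zero, sub_eq_zero, sub_eq_zero]
        simp only [Finset.mem_filter, Finset.mem_univ, true_and, Finset.mem_insert,
          Finset.mem_singleton, ← h4]
        exact ⟨fun h => h.2, fun h => ⟨hxF y h, h⟩⟩
      rw [h3, Finset.card_pair]
      · simp
      · intro h4
        exact hxF x hx ((mem_range_algebraMap_iff_pow_card x).2 h4.symm)
    · rintro ⟨a, rfl, rfl⟩
      exact h a (by ring)

theorem two_mul_card_lucasZeros (F : Type*) [Field F] [Fintype F] (k : ℕ) :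
    2 * (lucasZeros F k).card = (Fintype.card F - 1) *
      (((Fintype.card F - 1).gcd k - 1) + ((Fintype.card F + 1).gcd k - 1) +
        2 * if (k : F) = 0 then 1 else 0) := by
  obtain ⟨p, hp⟩ := CharP.exists F
  have : Fact p.Prime := ⟨CharP.char_is_prime F p⟩
  let K := FiniteField.Extension F p 2
  let _ : Fintype K := Fintype.ofFinite K
  have hK : Module.finrank F K = 2 := FiniteField.finrank_extension F p 2
  have hK' : Fintype.card K = Fintype.card F ^ 2 := by
    rw [← Nat.card_eq_fintype_card, ← Nat.card_eq_fintype_card]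
    exact FiniteField.natCard_extension F p 2
  have h := Finset.sum_congr (s₁ := lucasZeros F k) rfl fun q _ =>
    two_eq_card_roots (F := F) (K := K) hK q.1 q.2
  rw [Finset.sum_add_distrib, Finset.sum_add_distrib, sum_card_roots_lucasZeros,
    sum_card_nonrational_roots_lucasZeros hK', ← Finset.card_filter, card_lucasZeros_double,
    Finset.sum_const, smul_eq_mul] at h
  rw [mul_comm, h]
  ring

end Quadratics

/-! ### From matrices to `PGL(2, F)` -/

section ProjectiveCount

open Classical Matrix

variable (F : Type*) [Field F] [Fintype F]

theorem card_det_ne_zero_lucasU_eq_zero (k : ℕ) :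
    (Finset.univ.filter fun A : Matrix (Fin 2) (Fin 2) F =>
        A.det ≠ 0 ∧ lucasU A.trace A.det k = 0).card + (lucasZeros F k).card * Fintype.card F =
      (lucasZeros F k).card * Fintype.card F ^ 2 + (Fintype.card F - 1) *
        (((Fintype.card F - 1).gcd k - 1) + if (k : F) = 0 then 1 else 0) * Fintype.card F := by
  have h := Finset.card_eq_sum_card_fiberwise (s := Finset.univ.filter fun A : Matrix (Fin 2)
    (Fin 2) F => A.det ≠ 0 ∧ lucasU A.trace A.det k = 0) (t := lucasZeros F k)
    (f := fun A => (A.trace, A.det)) (by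
      intro A
      simp [mem_lucasZeros])
  have h2 : ∀ p ∈ lucasZeros F k, ((Finset.univ.filter fun A : Matrix (Fin 2)
      (Fin 2) F => A.det ≠ 0 ∧ lucasU A.trace A.det k = 0).filter
        fun A => (A.trace, A.det) = p).card =
      (Finset.univ.filter fun A : Matrix (Fin 2) (Fin 2) F =>
        A.trace = p.1 ∧ A.det = p.2).card := by
    rintro ⟨t, n⟩ hp
    rw [mem_lucasZeros] at hp
    rw [Finset.filter_filter]
    congr 1
    ext A
    simp only [Finset.mem_filter, Finset.mem_univ, true_and, Prod.mk.injEq]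
    constructor
    · exact fun h => h.2
    · rintro ⟨rfl, rfl⟩
      exact ⟨hp, rfl, rfl⟩
  rw [h, Finset.sum_congr rfl h2, ← smul_eq_mul (lucasZeros F k).card,
    ← Finset.sum_const, ← Finset.sum_add_distrib,
    Finset.sum_congr rfl fun p _ => card_trace_det p.1 p.2, Finset.sum_add_distrib,
    ← Finset.sum_mul, sum_card_roots_lucasZeros, Finset.sum_const, smul_eq_mul]

theorem card_scalar_filter (Q : Prop) :
    (Finset.univ.filter fun A : Matrix (Fin 2) (Fin 2) F =>
      A.det ≠ 0 ∧ A ∈ Set.range (scalar (Fin 2)) ∧ Q).card =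
      (Fintype.card F - 1) * if Q then 1 else 0 := by
  by_cases hQ : Q
  · have h : (Finset.univ.filter fun A : Matrix (Fin 2) (Fin 2) F =>
      A.det ≠ 0 ∧ A ∈ Set.range (scalar (Fin 2)) ∧ Q) =
      (Finset.univ.erase 0).image (scalar (Fin 2) : F → Matrix (Fin 2) (Fin 2) F) := by
      ext A
      simp only [Finset.mem_filter, Finset.mem_univ, true_and, Finset.mem_image,
        Finset.mem_erase, and_true, hQ]
      constructor
      · rintro ⟨h, c, rfl⟩
        exact ⟨c, by rintro rfl; simp at h, rfl⟩
      · rintro ⟨c, h, rfl⟩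
        exact ⟨by simpa using h, c, rfl⟩
    rw [h, Finset.card_image_of_injective _ (fun a b h => by simpa using congr_fun₂ h 0 0), if_pos hQ,
      Finset.card_erase_of_mem (Finset.mem_univ _), Finset.card_univ, mul_one]
  · simp [hQ]

/-- Inclusion–exclusion for `Matrix.pow_scalar_iff`: a nonzero scalar matrix has `Uₖ = 0` exactly
when `k = 0` in `F`. -/
theorem card_pow_mem_scalar (k : ℕ) :
    (Finset.univ.filter fun A : Matrix (Fin 2) (Fin 2) F =>
        A.det ≠ 0 ∧ A ^ k ∈ Set.range (scalar (Fin 2))).card +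
        (Fintype.card F - 1) * (if (k : F) = 0 then 1 else 0) =
      (Finset.univ.filter fun A : Matrix (Fin 2) (Fin 2) F =>
        A.det ≠ 0 ∧ lucasU A.trace A.det k = 0).card + (Fintype.card F - 1) := by
  have h1 := card_scalar_filter F True
  rw [if_pos trivial, mul_one] at h1
  nth_rw 2 [← h1]
  rw [← card_scalar_filter F, ← Finset.card_union_add_card_inter
    (Finset.univ.filter fun A : Matrix (Fin 2) (Fin 2) F =>
        A.det ≠ 0 ∧ lucasU A.trace A.det k = 0)]
  congr 2
  · ext A
    simp only [Finset.mem_filter, Finset.mem_univ, true_and, Finset.mem_union,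
      Matrix.pow_scalar_iff]
    tauto
  · ext A
    simp only [Finset.mem_filter, Finset.mem_univ, true_and, Finset.mem_inter, and_true]
    have : A.det ≠ 0 → A ∈ Set.range (scalar (Fin 2)) →
        (lucasU A.trace A.det k = 0 ↔ (k : F) = 0) := by
      rintro h ⟨c, rfl⟩
      have hc : c ≠ 0 := by rintro rfl; simp at h
      rw [Matrix.trace_fin_two, Matrix.det_fin_two]
      simpa using lucasU_self_eq_zero_iff hc k
    tauto

theorem card_center_GL_two : Nat.card (Subgroup.center (GL (Fin 2) F)) = Fintype.card F - 1 := by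
  rw [GeneralLinearGroup.center_eq_range_scalar, ← Fintype.card_units, ← Nat.card_eq_fintype_card]
  refine (Nat.card_congr (MonoidHom.ofInjective (f := GeneralLinearGroup.scalar (Fin 2)) ?_).toEquiv).symm
  intro a b h
  have h2 := congrArg (fun g : GL (Fin 2) F => (g : Matrix (Fin 2) (Fin 2) F) 0 0) h
  ext
  simpa using h2

/-- The preimage in `GL` is a union of cosets of the center, which has `q - 1` elements. -/
theorem card_center_mul_ncard_frobeniusSet (k : ℕ) :
    (Fintype.card F - 1) * (frobeniusSet PGL(2, F) k).ncard =
      (Finset.univ.filter fun A : Matrix (Fin 2) (Fin 2) F =>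
        A.det ≠ 0 ∧ A ^ k ∈ Set.range (scalar (Fin 2))).card := by
  rw [← card_center_GL_two, ← Nat.card_coe_set_eq]
  refine (QuotientGroup.card_preimage_mk (Subgroup.center (GL (Fin 2) F))
    (frobeniusSet PGL(2, F) k)).symm.trans ?_
  have hmem : ∀ g : GL (Fin 2) F, g ∈ ((QuotientGroup.mk :
      GL (Fin 2) F → GL (Fin 2) F ⧸ Subgroup.center (GL (Fin 2) F)) ⁻¹' (frobeniusSet PGL(2, F) k)) ↔
      (g : Matrix (Fin 2) (Fin 2) F) ^ k ∈ Set.range (scalar (Fin 2)) := by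
    intro g
    change (ProjGenLinGroup.mk g) ^ k = 1 ↔ _
    rw [← map_pow, ProjGenLinGroup.mk_eq_one,
      GeneralLinearGroup.mem_center_iff_val_mem_range_scalar, Units.val_pow_eq_pow_val]
  rw [← Set.ncard_coe_finset, Nat.card_coe_set_eq]
  refine Set.ncard_congr (fun g _ => (g : Matrix (Fin 2) (Fin 2) F)) ?_
    (fun g h _ _ hgh => Units.ext hgh) ?_
  · intro g hg
    rw [hmem] at hg
    simpa [-Set.mem_range, hg] using g.det_ne_zero
  · intro A hA
    simp only [Finset.mem_coe, Finset.mem_filter, Finset.mem_univ, true_and] at hA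
    exact ⟨GeneralLinearGroup.mkOfDetNeZero A hA.1, (hmem _).2 hA.2, rfl⟩

theorem two_mul_ncard_frobeniusSet_PGL_two (k : ℕ) (hk : 0 < k) :
    2 * ((frobeniusSet PGL(2, F) k).ncard : ℤ) =
      2 + (((Fintype.card F - 1).gcd k : ℤ) - 1) * ((Fintype.card F : ℤ) ^ 2 + Fintype.card F) +
        (((Fintype.card F + 1).gcd k : ℤ) - 1) * ((Fintype.card F : ℤ) ^ 2 - Fintype.card F) +
        (if (k : F) = 0 then 1 else 0) * (2 * ((Fintype.card F : ℤ) ^ 2 - 1)) := by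
  have h1 := card_center_mul_ncard_frobeniusSet F k
  have h2 := card_pow_mem_scalar F k
  have h3 := card_det_ne_zero_lucasU_eq_zero F k
  have h4 := two_mul_card_lucasZeros F k
  have hq := Fintype.one_lt_card (α := F)
  have hd : 1 ≤ (Fintype.card F - 1).gcd k := Nat.gcd_pos_of_pos_right _ hk
  have he : 1 ≤ (Fintype.card F + 1).gcd k := Nat.gcd_pos_of_pos_right _ hk
  rw [← h1] at h2
  generalize (Fintype.card F - 1).gcd k = d at *
  generalize (Fintype.card F + 1).gcd k = e at *
  generalize Fintype.card F = q at *
  have hu : (((if (k : F) = 0 then 1 else 0 : ℕ)) : ℤ) = if (k : F) = 0 then 1 else 0 := by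
    split_ifs <;> rfl
  rw [← hu]
  generalize (if (k : F) = 0 then 1 else 0 : ℕ) = u at *
  generalize (lucasZeros F k).card = P at *
  generalize (frobeniusSet PGL(2, F) k).ncard = L at *
  generalize (Finset.card _ : ℕ) = W at *
  zify [hd, he, hq.le] at h2 h3 h4
  have hq0 : (q : ℤ) - 1 ≠ 0 := by omega
  -- The matrix counts all carry the factor `q - 1`, the order of the center.
  apply mul_left_cancel₀ hq0
  linear_combination 2 * h2 + 2 * h3 + (q ^ 2 - q : ℤ) * h4

end ProjectiveCount

/-! ### Breadths of `PGL(2, F)` -/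

section Breadth

theorem globalBreadth_eq_of_forall_le {G : Type*} [Group G] [Finite G] {k : ℕ} {B : ℚ}
    (hk : k ∣ Nat.card G) (hB : localBreadth G k = B)
    (h : ∀ j, j ∣ Nat.card G → localBreadth G j ≤ B) : globalBreadth G = B := by
  apply le_antisymm
  · exact Finset.sup'_le _ _ fun j hj => h j (Nat.dvd_of_mem_divisors hj)
  · rw [← hB]
    exact Finset.le_sup' (localBreadth G) (Nat.mem_divisors.2 ⟨hk, Nat.card_pos.ne'⟩)

theorem localBreadth_le_of {G : Type*} [Group G] {k : ℕ} (hk : 0 < k) {B : ℤ}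
    (h : 2 * ((frobeniusSet G k).ncard : ℤ) ≤ k * B) : localBreadth G k ≤ B / 2 := by
  have hk' : (0 : ℚ) < k := by exact_mod_cast hk
  rw [localBreadth, div_le_div_iff₀ hk' two_pos]
  have h' : (2 * ((frobeniusSet G k).ncard : ℚ)) ≤ k * B := by exact_mod_cast h
  linarith

theorem localBreadth_eq_of {G : Type*} [Group G] {k : ℕ} (hk : 0 < k) {B : ℤ}
    (h : 2 * ((frobeniusSet G k).ncard : ℤ) = k * B) : localBreadth G k = B / 2 := by
  have hk' : (k : ℚ) ≠ 0 := by exact_mod_cast hk.ne'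
  rw [localBreadth, div_eq_div_iff hk' two_ne_zero]
  have h' : (2 * ((frobeniusSet G k).ncard : ℚ)) = k * B := by exact_mod_cast h
  linarith

theorem card_PGL_two (F : Type*) [Field F] [Fintype F] :
    Nat.card PGL(2, F) = (Fintype.card F - 1) * (Fintype.card F * (Fintype.card F + 1)) := by
  have h1 : Nat.card (GL (Fin 2) F) = Nat.card PGL(2, F) * (Fintype.card F - 1) := by
    rw [← card_center_GL_two]
    exact Subgroup.card_eq_card_quotient_mul_card_subgroup (Subgroup.center (GL (Fin 2) F))
  have hq := Fintype.one_lt_card (α := F)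
  have h0 : Fintype.card F - 1 ≠ 0 := by omega
  rw [Matrix.card_GL_field, Fin.prod_univ_two] at h1
  apply Nat.eq_of_mul_eq_mul_right (Nat.pos_of_ne_zero h0)
  rw [← h1]
  obtain ⟨r, hr⟩ := Nat.exists_eq_add_of_lt hq
  rw [hr]
  simp only [Fin.val_zero, Fin.val_one, pow_zero, pow_one, Nat.add_sub_cancel]
  rw [show (1 + r + 1) ^ 2 - 1 = (r + 1) * (r + 3) by apply Nat.sub_eq_of_eq_add; ring,
    show (1 + r + 1) ^ 2 - (1 + r + 1) = (r + 2) * (r + 1) by apply Nat.sub_eq_of_eq_add; ring]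
  ring

variable (F : Type*) [Field F] [Fintype F]

/-- The characteristic `p` divides `k` and is coprime to `d` and `e`, so `pd` and `pe` divide `k`.
The bound serves both parities of `q`. -/
theorem two_mul_ncard_frobeniusSet_PGL_two_le_of_cast_eq_zero {k : ℕ} (hk : 0 < k)
    (hkF : (k : F) = 0) :
    2 * ((frobeniusSet PGL(2, F) k).ncard : ℤ) ≤ k * (Fintype.card F : ℤ) ^ 2 := by
  obtain ⟨p, hp⟩ := CharP.exists F
  have hprime : p.Prime := CharP.char_is_prime F p
  have hpk : p ∣ k := (CharP.cast_eq_zero_iff F p k).1 hkF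
  have hpq : p ∣ Fintype.card F :=
    (CharP.cast_eq_zero_iff F p _).1 (FiniteField.cast_card_eq_zero F)
  have hq := Fintype.one_lt_card (α := F)
  have hcop : (Fintype.card F - 1).Coprime (Fintype.card F) := by
    have := (Nat.coprime_self_add_right (m := Fintype.card F - 1) (n := 1)).2
      (Nat.coprime_one_right _)
    rwa [Nat.sub_add_cancel hq.le] at this
  have hcop' : (Fintype.card F + 1).Coprime (Fintype.card F) := by simp
  rw [two_mul_ncard_frobeniusSet_PGL_two F k hk, if_pos hkF, one_mul]
  refine breadth_bound_of_mul_le (p := p) (Nat.le_of_dvd hk ?_) (Nat.le_of_dvd hk ?_) hq.le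
    hprime.two_le
  · exact mul_dvd_of_coprime_multiple hpq hpk (Nat.gcd_dvd_right _ _)
      (hcop.coprime_dvd_left (Nat.gcd_dvd_left _ _))
  · exact mul_dvd_of_coprime_multiple hpq hpk (Nat.gcd_dvd_right _ _)
      (hcop'.coprime_dvd_left (Nat.gcd_dvd_left _ _))

theorem localBreadth_PGL_two_le_odd (hq : 5 ≤ Fintype.card F) {k : ℕ} (hk : 0 < k) :
    localBreadth PGL(2, F) k ≤
      (((Fintype.card F : ℤ) ^ 2 + Fintype.card F - 2 : ℤ) : ℚ) / 2 := by
  apply localBreadth_le_of hk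
  by_cases hkF : (k : F) = 0
  · refine (two_mul_ncard_frobeniusSet_PGL_two_le_of_cast_eq_zero F hk hkF).trans ?_
    exact mul_le_mul_of_nonneg_left (by omega) (by positivity)
  · rw [two_mul_ncard_frobeniusSet_PGL_two F k hk, if_neg hkF, zero_mul, add_zero]
    exact breadth_bound_odd hq hk (Nat.gcd_dvd_right _ _) (Nat.gcd_dvd_right _ _)
      (Nat.gcd_dvd_left _ _) (Nat.gcd_dvd_left _ _)

theorem localBreadth_PGL_two_le_even (hq : 4 ≤ Fintype.card F) (hq2 : Even (Fintype.card F))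
    {k : ℕ} (hk : 0 < k) :
    localBreadth PGL(2, F) k ≤ (((Fintype.card F : ℤ) ^ 2 : ℤ) : ℚ) / 2 := by
  apply localBreadth_le_of hk
  by_cases hkF : (k : F) = 0
  · exact two_mul_ncard_frobeniusSet_PGL_two_le_of_cast_eq_zero F hk hkF
  · rw [two_mul_ncard_frobeniusSet_PGL_two F k hk, if_neg hkF, zero_mul, add_zero]
    exact breadth_bound_even hq hq2 hk (Nat.gcd_dvd_right _ _) (Nat.gcd_dvd_right _ _)
      (Nat.gcd_dvd_left _ _) (Nat.gcd_dvd_left _ _)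

theorem localBreadth_PGL_two_card_sub_one (hq : Odd (Fintype.card F)) :
    localBreadth PGL(2, F) (Fintype.card F - 1) =
      (((Fintype.card F : ℤ) ^ 2 + Fintype.card F - 2 : ℤ) : ℚ) / 2 := by
  have h1 := Fintype.one_lt_card (α := F)
  have hk : 0 < Fintype.card F - 1 := by omega
  apply localBreadth_eq_of hk
  have hkF : ((Fintype.card F - 1 : ℕ) : F) ≠ 0 := by
    rw [Nat.cast_sub h1.le, FiniteField.cast_card_eq_zero]
    simp
  have he : (Fintype.card F + 1).gcd (Fintype.card F - 1) = 2 := by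
    obtain ⟨r, hr⟩ := hq
    rw [hr, show 2 * r + 1 + 1 = 2 + (2 * r + 1 - 1) by omega, Nat.gcd_add_self_left]
    exact Nat.gcd_eq_left ⟨r, by omega⟩
  rw [two_mul_ncard_frobeniusSet_PGL_two F _ hk, if_neg hkF, he, Nat.gcd_self]
  push_cast [h1.le]
  ring

theorem localBreadth_PGL_two_two (hq : Even (Fintype.card F)) :
    localBreadth PGL(2, F) 2 = (((Fintype.card F : ℤ) ^ 2 : ℤ) : ℚ) / 2 := by
  have h1 := Fintype.one_lt_card (α := F)
  apply localBreadth_eq_of two_pos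
  obtain ⟨r, hr⟩ := hq
  have h2F : ((2 : ℕ) : F) = 0 := by
    have h0 := FiniteField.cast_card_eq_zero F
    have h2 : ringChar F = 2 := FiniteField.even_card_iff_char_two.2 (by omega)
    exact (ringChar.spec F 2).2 (by rw [h2])
  have hd : (Fintype.card F - 1).gcd 2 = 1 :=
    Nat.coprime_two_right.2 ⟨r - 1, by omega⟩
  have he : (Fintype.card F + 1).gcd 2 = 1 :=
    Nat.coprime_two_right.2 ⟨r, by omega⟩
  -- With `d = e = 1` only `2 + 2(q² - 1) = 2q²` survives.
  rw [two_mul_ncard_frobeniusSet_PGL_two F _ two_pos, if_pos h2F, hd, he]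
  push_cast
  ring

end Breadth

theorem corollary3p3 (F : Type*) [Field F] [Finite F] (q : ℕ) (hq : Nat.card F = q) :
    (Odd q → 5 ≤ q →
      globalBreadth PGL(2, F) = ((q : ℚ) ^ 2 + (q : ℚ) - 2) / 2 ∧
      (q - 1) ∣ Nat.card PGL(2, F) ∧
      localBreadth PGL(2, F) (q - 1) = globalBreadth PGL(2, F)) ∧
    (∀ m : ℕ, 2 ≤ m → q = 2 ^ m →
      globalBreadth PGL(2, F) = (2 : ℚ) ^ (2 * m - 1) ∧
      2 ∣ Nat.card PGL(2, F) ∧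
      localBreadth PGL(2, F) 2 = globalBreadth PGL(2, F)) := by
  have := Fintype.ofFinite F
  rw [Nat.card_eq_fintype_card] at hq
  have hpos : ∀ j, j ∣ Nat.card PGL(2, F) → 0 < j := fun j hj => Nat.pos_of_dvd_of_pos hj Nat.card_pos
  subst hq
  constructor
  · intro hodd h5
    have hdvd : (Fintype.card F - 1) ∣ Nat.card PGL(2, F) := card_PGL_two F ▸ dvd_mul_right _ _
    have hloc := localBreadth_PGL_two_card_sub_one F hodd
    have hglob := globalBreadth_eq_of_forall_le hdvd hloc
      fun j hj => localBreadth_PGL_two_le_odd F h5 (hpos j hj)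
    refine ⟨?_, hdvd, hloc.trans hglob.symm⟩
    rw [hglob]
    push_cast
    rfl
  · intro m hm hqm
    have heven : Even (Fintype.card F) := by
      rw [hqm]
      exact Nat.even_pow.2 ⟨even_two, by omega⟩
    have h4 : 4 ≤ Fintype.card F := by
      rw [hqm]
      exact Nat.pow_le_pow_right two_pos hm
    have hdvd : 2 ∣ Nat.card PGL(2, F) :=
      card_PGL_two F ▸ ((heven.two_dvd.mul_right _).mul_left _)
    have hloc := localBreadth_PGL_two_two F heven
    have hglob := globalBreadth_eq_of_forall_le hdvd hloc
      fun j hj => localBreadth_PGL_two_le_even F h4 heven (hpos j hj)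
    refine ⟨?_, hdvd, hloc.trans hglob.symm⟩
    rw [hglob, hqm]
    push_cast
    rw [← pow_mul, mul_comm m 2, div_eq_iff two_ne_zero, ← pow_succ]
    congr 1
    omega
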